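/- For positive integers $l,p$ with $p>2$ and $2l<p$, let $$C(l,p)=\Big\{\sum_{i=1}^{\infty}\frac{x_i}{p^i} : x_i\in\{0,\dots,l-1\}\cup\{p-l,\dots,p-1\}\text{ for all } i\Big\}\subset[0,1]$$ (the symmetric S-Cantor set). For $A,B\subset\mathbb R$ put $A-B=\{a-b: a\in A,\ b\in B\}$. A Cantor set is a nonempty, compact, perfect, nowhere dense subset of $\mathbb R$. A gap of $E\subset\mathbb R$ is a connected component of $\mathbb R\setminus E$ (bounded or not), and a proper component of $E$ is a connected component of $E$ that is not a singleton. A perfect set $E\subset\mathbb R$ is an M-Cantorval if it has infinitely many gaps and every (finite) endpoint of every gap is accumulated by gaps and by proper components of $E$, that is, each of its neighbourhoods contains a gap and a proper component of $E$. Let $l_1,l_2,p$ be positive integers with $p>2$, $2l_1<p$, $2l_2<p$. Then: 1. $C(l_1,p)-C(l_2,p)=[-1,1]$ if and only if $2l_1+l_2\ge p$ or $l_1+2l_2\ge p$; 2. $C(l_1,p)-C(l_2,p)$ is a Cantor set if and only if $2l_1+2l_2\le p$; 3. $C(l_1,p)-C(l_2,p)$ is an M-Cantorval if and only if $2l_1+l_2<p$,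 $l_1+2l_2<p$ and $2l_1+2l_2>p$. -/

import Mathlib

open scoped Pointwise

/-- A Cantor set in `ℝ`: nonempty, compact, perfect and nowhere dense. -/
def IsCantorSet (C : Set ℝ) : Prop :=
  C.Nonempty ∧ IsCompact C ∧ Perfect C ∧ IsNowhereDense C

/-- A gap of `E`: a connected component of the complement of `E`
(the unbounded ones are included). -/
def IsGap (E G : Set ℝ) : Prop :=
  ∃ x ∈ Eᶜ, G = connectedComponentIn Eᶜ x

/-- A proper component of `E`: a connected component of `E` that is not a singleton. -/
def IsProperComponent (E K : Set ℝ) : Prop :=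
  (∃ x ∈ E, K = connectedComponentIn E x) ∧ K.Nontrivial

/-- The (finite) endpoints of an interval `G`; an unbounded gap has just one or none. -/
def IsEndpoint (G : Set ℝ) (x : ℝ) : Prop :=
  IsGLB G x ∨ IsLUB G x

/-- `x` is accumulated by gaps and by proper components of `E`: each neighbourhood of `x`
contains a whole gap and a whole proper component. -/
def IsAccumulatedByGapsAndComponents (E : Set ℝ) (x : ℝ) : Prop :=
  ∀ ε : ℝ, 0 < ε →
    (∃ G, IsGap E G ∧ G ⊆ Set.Ioo (x - ε) (x + ε)) ∧
    (∃ K, IsProperComponent E K ∧ K ⊆ Set.Ioo (x - ε) (x + ε))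

/-- An M-Cantorval: a perfect set with infinitely many gaps such that both endpoints of any gap
are accumulated by gaps and proper components. -/
def IsMCantorval (E : Set ℝ) : Prop :=
  Perfect E ∧ {G : Set ℝ | IsGap E G}.Infinite ∧
    ∀ G, IsGap E G → ∀ x, IsEndpoint G x → IsAccumulatedByGapsAndComponents E x

/-- `A_p = {∑_{i ≥ 1} x_i / p^i : x_i ∈ A}`; the digit `x_{i+1}` is `d i`. -/
def digitSet (A : Finset ℤ) (p : ℕ) : Set ℝ :=
  {x | ∃ d : ℕ → ℤ, (∀ i, d i ∈ A) ∧ HasSum (fun i => (d i : ℝ) / (p : ℝ) ^ (i + 1)) x}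

/-- The digits `{0, …, l - 1} ∪ {p - r, …, p - 1}`. -/
noncomputable def sCantorDigits (l r p : ℕ) : Finset ℤ :=
  Finset.Icc 0 ((l : ℤ) - 1) ∪ Finset.Icc ((p : ℤ) - r) ((p : ℤ) - 1)

/-- The S-Cantor set `C(l, r, p)`. -/
def sCantor (l r p : ℕ) : Set ℝ :=
  digitSet (sCantorDigits l r p) p

/-- The symmetric S-Cantor set `C(l, p) = C(l, l, p)`. -/
def symmSCantor (l p : ℕ) : Set ℝ :=
  sCantor l l p

open Set Filter Topology

/-! ### Self-similarity of digit sets -/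

/-! Subtracting digitwise, the difference is the digit set E of `A = D₁ - D₂`
(`digitSet_sub_digitSet`). With m = max(l₁, l₂) and s = l₁ + l₂, A consists of the d with |d| < m or
p - s < |d| < p. Since E ⊆ [-1, 1] is the union of the copies (w + E)/p^n over words w, everything
depends on which integers A misses.

If s + m ≥ p, no two consecutive integers in (-p, p) are missing, every point of [-1, 1] has an
expansion, and E = [-1, 1] (`subset_digitSet_of_covered`). Otherwise m and m + 1 are missing, and E
avoids (m/p, (m + 1)/p).

If 2s > p, A meets every class mod p, so the integer translates of E cover the line and Baire gives
interior (`interior_digitSet_nonempty`). If 2s ≤ p, some t in (0, 1) has t, t - 1 ∉ E, and scaled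
copies of this hole are dense (`interior_digitSet_eq_empty`).

In the remaining case E has interior and a hole in (0, 1). Left of a right-isolated point, E is a
scaled copy of E left of 1 (`word_add_div_mem_iff`), where the digit p - 1 repeats the picture of
(0, 1) at every scale p^(-k). So gaps and intervals accumulate there; A = -A handles the other side
(`isMCantorval_digitSet`). -/

/-- The integers `∑_{i < n} d_i p^i` with digits `d_i ∈ A`. -/
def digitWords (A : Finset ℤ) (p : ℕ) : ℕ → Set ℤ
  | 0 => {0}
  | n + 1 => {w | ∃ v ∈ digitWords A p n, ∃ d ∈ A, w = p * v + d}

theorem hasSum_digits_succ {p : ℕ} (hp : 2 ≤ p) (d : ℕ → ℤ) (y : ℝ) :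
    HasSum (fun i => (d (i + 1) : ℝ) / (p : ℝ) ^ (i + 1)) y ↔
      HasSum (fun i => (d i : ℝ) / (p : ℝ) ^ (i + 1)) ((d 0 + y) / p) := by
  have hp0 : (p : ℝ) ≠ 0 := by positivity
  rw [← hasSum_div_const_iff hp0,
    ← hasSum_nat_add_iff' (f := fun i => (d i : ℝ) / (p : ℝ) ^ (i + 1)) 1]
  congr! 1
  · ext i
    rw [div_div, ← pow_succ]
  · simp
    ring

theorem mem_digitSet_iff_first {A : Finset ℤ} {p : ℕ} (hp : 2 ≤ p) {x : ℝ} :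
    x ∈ digitSet A p ↔ ∃ d ∈ A, ∃ y ∈ digitSet A p, x = (d + y) / p := by
  have hp0 : (p : ℝ) ≠ 0 := by positivity
  constructor
  · rintro ⟨d, hd, hx⟩
    refine ⟨d 0, hd 0, p * x - d 0, ⟨fun i => d (i + 1), fun i => hd _, ?_⟩, by field_simp; ring⟩
    rw [hasSum_digits_succ hp]
    convert hx using 1
    field_simp
    ring
  · rintro ⟨a, ha, y, ⟨d, hd, hy⟩, rfl⟩
    obtain ⟨e, e0, es⟩ : ∃ e : ℕ → ℤ, e 0 = a ∧ ∀ i, e (i + 1) = d i :=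
      ⟨fun i => Nat.casesOn i a d, rfl, fun _ => rfl⟩
    refine ⟨e, fun i => ?_, ?_⟩
    · cases i
      · rwa [e0]
      · rw [es]
        exact hd _
    · rw [← e0, ← hasSum_digits_succ hp]
      simpa only [es] using hy

theorem mem_digitSet_iff_word {A : Finset ℤ} {p : ℕ} (hp : 2 ≤ p) (n : ℕ) {x : ℝ} :
    x ∈ digitSet A p ↔ ∃ w ∈ digitWords A p n, ∃ y ∈ digitSet A p, x = (w + y) / p ^ n := by
  have hp0 : (p : ℝ) ≠ 0 := by positivity
  induction n with
  | zero =>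
    simp only [digitWords, mem_singleton_iff, exists_eq_left, Int.cast_zero, zero_add, pow_zero,
      div_one, exists_eq_right']
  | succ n ih =>
    refine ih.trans ?_
    constructor
    · rintro ⟨w, hw, y, hy, rfl⟩
      obtain ⟨d, hd, z, hz, rfl⟩ := (mem_digitSet_iff_first hp).1 hy
      refine ⟨p * w + d, ⟨w, hw, d, hd, rfl⟩, z, hz, ?_⟩
      push_cast
      field_simp
      ring
    · rintro ⟨_, ⟨w, hw, d, hd, rfl⟩, y, hy, rfl⟩
      refine ⟨w, hw, (d + y) / p, (mem_digitSet_iff_first hp).2 ⟨d, hd, y, hy, rfl⟩, ?_⟩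
      push_cast
      field_simp
      ring

theorem hasSum_geometric_digits {p : ℕ} (hp : 2 ≤ p) :
    HasSum (fun i : ℕ => ((p : ℝ) - 1) / (p : ℝ) ^ (i + 1)) 1 := by
  have hp0 : (2 : ℝ) ≤ p := by exact_mod_cast hp
  have h := (hasSum_geometric_of_lt_one (r := (p : ℝ)⁻¹) (by positivity)
    (inv_lt_one_of_one_lt₀ (by linarith))).mul_left (((p : ℝ) - 1) / p)
  have h0 : (p : ℝ) ≠ 0 := by linarith
  have h1 : (p : ℝ) - 1 ≠ 0 := by linarith
  have hv : ((p : ℝ) - 1) / p * (1 - (p : ℝ)⁻¹)⁻¹ = 1 := by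
    rw [inv_eq_one_div (p : ℝ), one_sub_div h0, inv_div]
    field_simp
  have hf : (fun i : ℕ => ((p : ℝ) - 1) / (p : ℝ) ^ (i + 1)) =
      fun i => ((p : ℝ) - 1) / p * (p : ℝ)⁻¹ ^ i := by
    ext i
    rw [inv_pow, pow_succ', ← div_eq_mul_inv, div_div]
  rw [hv] at h
  rwa [hf]

theorem abs_digit_div_le {A : Finset ℤ} {p : ℕ} (hA : ∀ d ∈ A, |d| < p) {a : ℤ}
    (ha : a ∈ A) (i : ℕ) : |(a : ℝ) / (p : ℝ) ^ (i + 1)| ≤ ((p : ℝ) - 1) / (p : ℝ) ^ (i + 1) := by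
  rw [abs_div, abs_of_nonneg (by positivity : (0 : ℝ) ≤ (p : ℝ) ^ (i + 1))]
  gcongr
  have : |a| ≤ (p : ℤ) - 1 := by linarith [Int.add_one_le_iff.2 (hA a ha)]
  exact_mod_cast this

theorem abs_le_one_of_mem_digitSet {A : Finset ℤ} {p : ℕ} (hp : 2 ≤ p)
    (hA : ∀ d ∈ A, |d| < p) {x : ℝ} (hx : x ∈ digitSet A p) : |x| ≤ 1 := by
  obtain ⟨d, hd, hx⟩ := hx
  have h1 := hasSum_geometric_digits hp
  have h2 := fun i => abs_le.1 (abs_digit_div_le hA (hd i) i)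
  exact abs_le.2 ⟨hasSum_le (fun i => (h2 i).1) h1.neg hx, hasSum_le (fun i => (h2 i).2) hx h1⟩

/-- The sum is uniformly convergent, hence continuous on the compact product of the finite digit
alphabets. -/
theorem isCompact_digitSet {A : Finset ℤ} {p : ℕ} (hp : 2 ≤ p) (hA : ∀ d ∈ A, |d| < p) :
    IsCompact (digitSet A p) := by
  have hs := (hasSum_geometric_digits hp).summable
  have hb : ∀ (i : ℕ) (d : ℕ → A),
      ‖((d i : ℤ) : ℝ) / (p : ℝ) ^ (i + 1)‖ ≤ ((p : ℝ) - 1) / (p : ℝ) ^ (i + 1) :=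
    fun i d => abs_digit_div_le hA (d i).2 i
  have hc : Continuous fun d : ℕ → A => ∑' i, ((d i : ℤ) : ℝ) / (p : ℝ) ^ (i + 1) := by
    refine continuous_tsum (fun i => ?_) hs hb
    exact ((continuous_of_discreteTopology (f := fun a : A => ((a : ℤ) : ℝ))).comp
      (continuous_apply i)).div_const _
  convert isCompact_range hc
  ext x
  constructor
  · rintro ⟨d, hd, hx⟩
    exact ⟨fun i => ⟨d i, hd i⟩, hx.tsum_eq⟩
  · rintro ⟨d, rfl⟩
    exact ⟨fun i => d i, fun i => (d i).2, (hs.of_norm_bounded fun i => hb i d).hasSum⟩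

/-- Iterating the hypothesis n times puts x within p^(-n) of a finite expansion padded with zeros;
closedness finishes. -/
theorem subset_digitSet_of_covered {A : Finset ℤ} {p : ℕ} (hp : 2 ≤ p)
    (hA : ∀ d ∈ A, |d| < p) {K : Set ℝ} (hK : ∀ x ∈ K, |x| ≤ 1)
    (h : ∀ x ∈ K, ∃ d ∈ A, (p : ℝ) * x - d ∈ K) (h0 : (0 : ℤ) ∈ A) : K ⊆ digitSet A p := by
  have hp0 : (p : ℝ) ≠ 0 := by positivity
  have hz : (0 : ℝ) ∈ digitSet A p := ⟨fun _ => 0, fun _ => h0, by simp⟩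
  have key : ∀ n : ℕ, ∀ x ∈ K, ∃ w ∈ digitWords A p n, ∃ y ∈ K, x = (w + y) / p ^ n := by
    intro n
    induction n with
    | zero => exact fun x hx => ⟨0, rfl, x, hx, by simp⟩
    | succ n ih =>
      intro x hx
      obtain ⟨w, hw, y, hy, rfl⟩ := ih x hx
      obtain ⟨d, hd, hz⟩ := h y hy
      refine ⟨p * w + d, ⟨w, hw, d, hd, rfl⟩, _, hz, ?_⟩
      push_cast
      field_simp
      ring
  intro x hx
  rw [← (isCompact_digitSet hp hA).isClosed.closure_eq, Metric.mem_closure_iff]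
  intro ε hε
  obtain ⟨n, hn⟩ := pow_unbounded_of_one_lt ε⁻¹ (by exact_mod_cast hp : (1 : ℝ) < p)
  obtain ⟨w, hw, y, hy, rfl⟩ := key n x hx
  refine ⟨_, (mem_digitSet_iff_word hp n).2 ⟨w, hw, 0, hz, rfl⟩, ?_⟩
  have hpn : (0 : ℝ) < (p : ℝ) ^ n := by positivity
  rw [Real.dist_eq, ← sub_div, abs_div, abs_of_pos hpn, div_lt_iff₀ hpn]
  have := hK y hy
  rw [inv_lt_iff_one_lt_mul₀ hε] at hn
  simp only [add_zero, add_sub_cancel_left]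
  linarith

open scoped Pointwise in
theorem digitSet_sub_digitSet {A B : Finset ℤ} {p : ℕ} (hp : 2 ≤ p) :
    digitSet A p - digitSet B p = digitSet (A - B) p := by
  ext x
  rw [Set.mem_sub]
  constructor
  · rintro ⟨a, ⟨d, hd, ha⟩, b, ⟨e, he, hb⟩, rfl⟩
    refine ⟨fun i => d i - e i, fun i => Finset.sub_mem_sub (hd i) (he i), ?_⟩
    simpa only [Int.cast_sub, sub_div] using ha.sub hb
  · rintro ⟨d, hd, hx⟩
    choose a ha b hb hab using fun i => Finset.mem_sub.1 (hd i)
    have hs : ∀ (C : Finset ℤ) (c : ℕ → ℤ), (∀ i, c i ∈ C) →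
        Summable fun i => (c i : ℝ) / (p : ℝ) ^ (i + 1) := by
      intro C c hc
      have hp0 : (2 : ℝ) ≤ p := by exact_mod_cast hp
      obtain ⟨M, hM⟩ := (C.image fun z : ℤ => |(z : ℝ)|).bddAbove
      refine Summable.of_norm_bounded (((summable_geometric_of_lt_one
        (inv_nonneg.2 (by positivity : (0 : ℝ) ≤ p)) (inv_lt_one_of_one_lt₀ (by linarith))).mul_left
        (M * (p : ℝ)⁻¹))) fun i => ?_
      rw [Real.norm_eq_abs, abs_div, abs_of_nonneg (by positivity : (0 : ℝ) ≤ (p : ℝ) ^ (i + 1)),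
        mul_assoc, ← pow_succ', inv_pow, ← div_eq_mul_inv]
      gcongr
      exact hM (Finset.mem_coe.2 (Finset.mem_image_of_mem _ (hc i)))
    have ha' := (hs A a ha).hasSum
    have hb' := (hs B b hb).hasSum
    refine ⟨_, ⟨a, ha, ha'⟩, _, ⟨b, hb, hb'⟩, HasSum.unique ?_ hx⟩
    simpa only [← hab, Int.cast_sub, sub_div] using ha'.sub hb'

theorem abs_lt_of_mem_digitWords {A : Finset ℤ} {p : ℕ}
    (hA : ∀ d ∈ A, |d| < p) {n : ℕ} {w : ℤ} (hw : w ∈ digitWords A p n) : |w| < (p : ℤ) ^ n := by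
  induction n generalizing w with
  | zero =>
    obtain rfl : w = 0 := hw
    simp
  | succ n ih =>
    obtain ⟨v, hv, d, hd, rfl⟩ := hw
    have h1 := abs_lt.1 (ih hv)
    have h2 := abs_lt.1 (hA d hd)
    rw [abs_lt, pow_succ]
    constructor <;> nlinarith

theorem pow_sub_one_mem_digitWords {A : Finset ℤ} {p : ℕ} (h1 : (p : ℤ) - 1 ∈ A) (n : ℕ) :
    (p : ℤ) ^ n - 1 ∈ digitWords A p n := by
  induction n with
  | zero => simp [digitWords]
  | succ n ih => exact ⟨_, ih, _, h1, by ring⟩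

theorem perfect_digitSet {A : Finset ℤ} {p : ℕ} (hp : 2 ≤ p) (hA : ∀ d ∈ A, |d| < p)
    (h0 : (0 : ℝ) ∈ digitSet A p) (h1 : (1 : ℝ) ∈ digitSet A p) : Perfect (digitSet A p) := by
  refine ⟨(isCompact_digitSet hp hA).isClosed, fun x hx => ?_⟩
  rw [accPt_iff_nhds]
  intro U hU
  obtain ⟨ε, hε, hU⟩ := Metric.mem_nhds_iff.1 hU
  -- The factor 2 bounds the distance between two tails in [-1, 1].
  obtain ⟨n, hn⟩ := pow_unbounded_of_one_lt (2 * ε⁻¹) (by exact_mod_cast hp : (1 : ℝ) < p)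
  obtain ⟨w, hw, y, hy, rfl⟩ := (mem_digitSet_iff_word hp n).1 hx
  have hpn : (0 : ℝ) < (p : ℝ) ^ n := by positivity
  obtain ⟨z, hz, hzy⟩ : ∃ z ∈ digitSet A p, z ≠ y := by
    rcases eq_or_ne y 0 with rfl | h
    · exact ⟨1, h1, one_ne_zero⟩
    · exact ⟨0, h0, h.symm⟩
  have hz' := (mem_digitSet_iff_word hp n).2 ⟨w, hw, z, hz, rfl⟩
  refine ⟨_, ⟨hU ?_, hz'⟩, ?_⟩
  · rw [Metric.mem_ball, Real.dist_eq, ← sub_div, abs_div, abs_of_pos hpn, div_lt_iff₀ hpn]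
    have a1 := abs_le.1 (abs_le_one_of_mem_digitSet hp hA hy)
    have a2 := abs_le.1 (abs_le_one_of_mem_digitSet hp hA hz)
    have : |(w : ℝ) + z - (w + y)| ≤ 2 := abs_le.2 ⟨by linarith, by linarith⟩
    have h3 := mul_lt_mul_of_pos_left hn hε
    field_simp at h3
    linarith
  · intro h
    rw [div_left_inj' hpn.ne'] at h
    exact hzy (by linarith)

theorem neg_mem_digitSet {A : Finset ℤ} {p : ℕ} (hA : ∀ d ∈ A, -d ∈ A) {x : ℝ}
    (hx : x ∈ digitSet A p) : -x ∈ digitSet A p := by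
  obtain ⟨d, hd, hx⟩ := hx
  refine ⟨fun i => -d i, fun i => hA _ (hd i), ?_⟩
  simpa only [Int.cast_neg, neg_div] using hx.neg

/-! ### Interior of a digit set -/

/-- A digit set whose digits cover all residues has nonempty interior. -/
theorem interior_digitSet_nonempty {A : Finset ℤ} {p : ℕ} (hp : 2 ≤ p) (hA : ∀ d ∈ A, |d| < p)
    (h0 : (0 : ℝ) ∈ digitSet A p) (hres : ∀ k : ℤ, ∃ d ∈ A, (p : ℤ) ∣ k - d) :
    (interior (digitSet A p)).Nonempty := by
  have hc := isCompact_digitSet hp hA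
  -- Words of length n meet every class mod p^n, so E + ℤ is dense; it is closed, being compact plus
  -- closed.
  have hw : ∀ n : ℕ, ∀ k : ℤ, ∃ w ∈ digitWords A p n, (p : ℤ) ^ n ∣ k - w := by
    intro n
    induction n with
    | zero => exact fun k => ⟨0, rfl, by simp⟩
    | succ n ih =>
      intro k
      obtain ⟨d, hd, j, hj⟩ := hres k
      obtain ⟨w, hw, i, hi⟩ := ih j
      refine ⟨p * w + d, ⟨w, hw, d, hd, rfl⟩, i, ?_⟩
      rw [pow_succ]
      linear_combination hj + p * hi
  have hcl : IsClosed (digitSet A p + range ((↑) : ℤ → ℝ)) :=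
    Int.isClosedEmbedding_coe_real.isClosed_range.add_left_of_isCompact hc
  have huniv : digitSet A p + range ((↑) : ℤ → ℝ) = univ := by
    refine eq_univ_of_forall fun x => ?_
    rw [← hcl.closure_eq, Metric.mem_closure_iff]
    intro ε hε
    obtain ⟨n, hn⟩ := pow_unbounded_of_one_lt ε⁻¹ (by exact_mod_cast hp : (1 : ℝ) < p)
    have hpn : (0 : ℝ) < (p : ℝ) ^ n := by positivity
    obtain ⟨w, hw, j, hj⟩ := hw n ⌊x * p ^ n⌋
    refine ⟨w / p ^ n + j, add_mem_add ((mem_digitSet_iff_word hp n).2 ⟨w, hw, 0, h0, by simp⟩)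
      ⟨j, rfl⟩, ?_⟩
    have hj' : (⌊x * p ^ n⌋ : ℝ) - w = p ^ n * j := by exact_mod_cast hj
    have e : x - (w / (p : ℝ) ^ n + j) = (x * p ^ n - ⌊x * p ^ n⌋) / p ^ n := by
      field_simp
      linear_combination hj'
    rw [Real.dist_eq, e, abs_div, abs_of_pos hpn, div_lt_iff₀ hpn, Int.self_sub_floor,
      abs_of_nonneg (Int.fract_nonneg _)]
    rw [inv_lt_iff_one_lt_mul₀ hε] at hn
    linarith [Int.fract_lt_one (x * p ^ n)]
  have hU : ⋃ j : ℤ, (fun x : ℝ => x + j) '' digitSet A p = univ := by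
    refine eq_univ_of_forall fun x => ?_
    obtain ⟨a, ha, _, ⟨j, rfl⟩, rfl⟩ := huniv.ge (mem_univ x)
    exact mem_iUnion.2 ⟨j, a, ha, rfl⟩
  -- Baire: one of the countably many closed translates has interior.
  obtain ⟨j, x, hx⟩ := nonempty_interior_of_iUnion_of_closed
    (fun j : ℤ => ((Homeomorph.addRight (j : ℝ)).isClosed_image).2 hc.isClosed) hU
  have hx' := (Homeomorph.addRight (j : ℝ)).image_interior (digitSet A p) ▸ hx
  obtain ⟨y, hy, -⟩ := hx'
  exact ⟨y, hy⟩

/-- A digit set is nowhere dense if some `t ∈ (0, 1)` is not congruent mod 1 to a member. -/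
theorem interior_digitSet_eq_empty {A : Finset ℤ} {p : ℕ} (hp : 2 ≤ p) (hA : ∀ d ∈ A, |d| < p)
    {t : ℝ} (ht0 : 0 < t) (ht1 : t < 1) (ht : t ∉ digitSet A p) (ht' : t - 1 ∉ digitSet A p) :
    interior (digitSet A p) = ∅ := by
  by_contra hne
  obtain ⟨x, hx⟩ := nonempty_iff_ne_empty.2 hne
  obtain ⟨ε, hε, hU⟩ := Metric.isOpen_iff.1 isOpen_interior x hx
  obtain ⟨n, hn⟩ := pow_unbounded_of_one_lt ε⁻¹ (by exact_mod_cast hp : (1 : ℝ) < p)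
  have hpn : (0 : ℝ) < (p : ℝ) ^ n := by positivity
  have e : (⌊x * p ^ n - t⌋ + t) / p ^ n - x = - Int.fract (x * p ^ n - t) / p ^ n := by
    rw [← Int.self_sub_floor]
    field_simp
    ring
  have hm : (⌊x * p ^ n - t⌋ + t) / p ^ n ∈ digitSet A p := by
    refine interior_subset (hU ?_)
    rw [Metric.mem_ball, Real.dist_eq, e, abs_div, abs_of_pos hpn, div_lt_iff₀ hpn, abs_neg,
      abs_of_nonneg (Int.fract_nonneg _)]
    rw [inv_lt_iff_one_lt_mul₀ hε] at hn
    linarith [Int.fract_lt_one (x * p ^ n - t)]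
  obtain ⟨w, hw, y, hy, h⟩ := (mem_digitSet_iff_word hp n).1 hm
  rw [div_left_inj' hpn.ne'] at h
  obtain ⟨h1, h2⟩ := abs_le.1 (abs_le_one_of_mem_digitSet hp hA hy)
  set j := ⌊x * p ^ n - t⌋
  have e1 : (-2 : ℝ) < ((j - w : ℤ) : ℝ) := by push_cast; linarith
  have e2 : ((j - w : ℤ) : ℝ) < 1 := by push_cast; linarith
  have e1' : -2 < j - w := by exact_mod_cast e1
  have e2' : j - w < 1 := by exact_mod_cast e2
  -- The tail y = j - w + t lies in [-1, 1], so it is t or t - 1.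
  obtain h3 | h3 : j = w ∨ j = w - 1 := by omega
  · rw [h3] at h
    exact ht (by convert hy using 1; linarith)
  · rw [h3] at h
    push_cast at h
    exact ht' (by convert hy using 1; linarith)

/-! ### Local shape at a gap endpoint -/

/-- Immediately to the left of `(w + 1) / p ^ n`, where `w` is a word and `w + 1` is not,
the set looks like it does in `(0, 1)`. -/
theorem word_add_div_mem_iff {A : Finset ℤ} {p : ℕ} (hp : 2 ≤ p) (hA : ∀ d ∈ A, |d| < p)
    {n : ℕ} {w : ℤ} (hw : w ∈ digitWords A p n) (hw' : w + 1 ∉ digitWords A p n) {y : ℝ}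
    (hy0 : 0 < y) (hy1 : y < 1) : (w + y) / p ^ n ∈ digitSet A p ↔ y ∈ digitSet A p := by
  have hpn : (0 : ℝ) < (p : ℝ) ^ n := by positivity
  refine ⟨fun h => ?_, fun h => (mem_digitSet_iff_word hp n).2 ⟨w, hw, y, h, rfl⟩⟩
  obtain ⟨v, hv, z, hz, h⟩ := (mem_digitSet_iff_word hp n).1 h
  rw [div_left_inj' hpn.ne'] at h
  obtain ⟨h1, h2⟩ := abs_le.1 (abs_le_one_of_mem_digitSet hp hA hz)
  have e1 : (-1 : ℝ) < ((v - w : ℤ) : ℝ) := by push_cast; linarith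
  have e2 : ((v - w : ℤ) : ℝ) < 2 := by push_cast; linarith
  have e1' : -1 < v - w := by exact_mod_cast e1
  have e2' : v - w < 2 := by exact_mod_cast e2
  obtain h3 | h3 : v = w ∨ v = w + 1 := by omega
  · subst h3
    exact (by linarith : y = z) ▸ hz
  · exact absurd (h3 ▸ hv) hw'

/-- A point isolated from the right is `(w + 1) / p ^ n` for a word `w` such that `w + 1` is not
a word. -/
theorem exists_word_of_isolated_right {A : Finset ℤ} {p : ℕ} (hp : 2 ≤ p)
    (hA : ∀ d ∈ A, |d| < p) (h1 : (1 : ℝ) ∈ digitSet A p) {a δ : ℝ}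
    (ha : a ∈ digitSet A p) (hδ : 0 < δ) (hgap : ∀ x, a < x → x < a + δ → x ∉ digitSet A p) :
    ∃ n, ∃ w ∈ digitWords A p n, w + 1 ∉ digitWords A p n ∧ a = (w + 1) / p ^ n := by
  obtain ⟨n, hn⟩ := pow_unbounded_of_one_lt (2 * δ⁻¹) (by exact_mod_cast hp : (1 : ℝ) < p)
  have hpn : (0 : ℝ) < (p : ℝ) ^ n := by positivity
  have hn' : 2 < δ * p ^ n := by
    have h3 := mul_lt_mul_of_pos_left hn hδ
    field_simp at h3
    linarith
  obtain ⟨w, hw, y, hy, rfl⟩ := (mem_digitSet_iff_word hp n).1 ha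
  obtain ⟨hy1, hy2⟩ := abs_le.1 (abs_le_one_of_mem_digitSet hp hA hy)
  have hfree : ∀ v ∈ digitWords A p n, ∀ z ∈ digitSet A p, (w : ℝ) + y < v + z →
      w + y + 2 < v + z := by
    intro v hv z hz hlt
    by_contra! hle
    refine hgap ((v + z) / p ^ n) (div_lt_div_of_pos_right hlt hpn) ?_
      ((mem_digitSet_iff_word hp n).2 ⟨v, hv, z, hz, rfl⟩)
    rw [div_add' _ _ _ hpn.ne']
    exact div_lt_div_of_pos_right (by linarith) hpn
  -- If y < 1, then w + 1 is a scaled point less than or equal to 2 to the right, inside the hole.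
  obtain rfl : y = 1 := by
    by_contra hne
    have := hfree w hw 1 h1 (by linarith [lt_of_le_of_ne hy2 hne])
    linarith
  refine ⟨n, w, hw, fun hw' => ?_, rfl⟩
  have := hfree (w + 1) hw' 1 h1 (by push_cast; linarith)
  push_cast at this
  linarith

/-! ### Gaps and components of subsets of the line -/

/-- Components are intervals, so one is trapped between any two points outside the set; it suffices
to exhibit such points. -/
theorem isAccumulatedByGapsAndComponents_of {E : Set ℝ} {x : ℝ}
    (h : ∀ ε : ℝ, 0 < ε →
      (∃ a b u, x - ε < a ∧ a < u ∧ u < b ∧ b < x + ε ∧ a ∈ E ∧ u ∉ E ∧ b ∈ E) ∧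
      (∃ u v c d, x - ε < u ∧ u < c ∧ c < d ∧ d < v ∧ v < x + ε ∧ u ∉ E ∧ v ∉ E ∧
        Icc c d ⊆ E)) : IsAccumulatedByGapsAndComponents E x := by
  have key : ∀ (F : Set ℝ) (a u b : ℝ), a < u → u < b → a ∉ F → b ∉ F → u ∈ F →
      connectedComponentIn F u ⊆ Ioo a b := by
    intro F a u b hau hub ha hb hu y hy
    have hoc := (isPreconnected_connectedComponentIn (F := F) (x := u)).ordConnected
    have hmu := mem_connectedComponentIn hu
    have hsub := connectedComponentIn_subset F u
    constructor
    · by_contra! hle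
      exact ha (hsub (hoc.out hy hmu ⟨hle, hau.le⟩))
    · by_contra! hle
      exact hb (hsub (hoc.out hmu hy ⟨hub.le, hle⟩))
  intro ε hε
  obtain ⟨⟨a, b, u, h1, h2, h3, h4, h5, h6, h7⟩, u', v, c, d, g1, g2, g3, g4, g5, g6, g7, g8⟩ :=
    h ε hε
  refine ⟨⟨_, ⟨u, h6, rfl⟩, ?_⟩, _, ⟨⟨c, g8 ⟨le_rfl, g3.le⟩, rfl⟩, ?_⟩, ?_⟩
  · exact (key Eᶜ a u b h2 h3 (not_not.2 h5) (not_not.2 h7) h6).trans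
      (Ioo_subset_Ioo h1.le h4.le)
  · refine ⟨c, mem_connectedComponentIn (g8 ⟨le_rfl, g3.le⟩), d, ?_, g3.ne⟩
    exact isPreconnected_Icc.subset_connectedComponentIn ⟨le_rfl, g3.le⟩ g8 ⟨g3.le, le_rfl⟩
  · exact (key E u' c v g2 (g3.trans g4) g6 g7 (g8 ⟨le_rfl, g3.le⟩)).trans
      (Ioo_subset_Ioo g1.le g5.le)

/-- A gap is open, so its endpoint is in the closure but not in the gap; outside E it could be
adjoined to the component. -/
theorem isolated_of_isEndpoint {E G : Set ℝ} (hE : IsClosed E) (hG : IsGap E G) {a : ℝ}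
    (ha : IsEndpoint G a) : a ∈ E ∧ ∃ δ > 0, (∀ x, a < x → x < a + δ → x ∉ E) ∨
      (∀ x, a - δ < x → x < a → x ∉ E) := by
  obtain ⟨g, hg, rfl⟩ := hG
  have hop : IsOpen (connectedComponentIn Eᶜ g) := hE.isOpen_compl.connectedComponentIn
  have hoc := (isPreconnected_connectedComponentIn (F := Eᶜ) (x := g)).ordConnected
  have hmg := mem_connectedComponentIn hg
  have hsub := connectedComponentIn_subset Eᶜ g
  have hnot : a ∉ connectedComponentIn Eᶜ g := by
    intro hm
    obtain ⟨ε, hε, hb⟩ := Metric.isOpen_iff.1 hop a hm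
    rcases ha with ha | ha
    · have := ha.1 (hb (by simp [abs_of_pos hε, hε] : a - ε / 2 ∈ Metric.ball a ε))
      linarith
    · have := ha.1 (hb (by simp [abs_of_pos hε, hε] : a + ε / 2 ∈ Metric.ball a ε))
      linarith
  have hcl : a ∈ closure (connectedComponentIn Eᶜ g) := by
    rcases ha with ha | ha
    · exact ha.mem_closure ⟨g, hmg⟩
    · exact ha.mem_closure ⟨g, hmg⟩
  refine ⟨?_, ?_⟩
  · by_contra haE
    have hpre : IsPreconnected (insert a (connectedComponentIn Eᶜ g)) :=
      isPreconnected_connectedComponentIn.subset_closure (subset_insert _ _)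
        (insert_subset hcl subset_closure)
    exact hnot (hpre.subset_connectedComponentIn (mem_insert_of_mem _ hmg)
      (insert_subset haE hsub) (mem_insert _ _))
  · have hne : g ≠ a := fun h => hnot (h ▸ hmg)
    rcases ha with ha | ha
    · refine ⟨g - a, sub_pos.2 (lt_of_le_of_ne (ha.1 hmg) hne.symm), .inl fun x hx hx' => ?_⟩
      obtain ⟨y, hy, hyx⟩ := (isGLB_lt_iff ha).1 hx
      exact hsub (hoc.out hy hmg ⟨hyx.le, by linarith⟩)
    · refine ⟨a - g, sub_pos.2 (lt_of_le_of_ne (ha.1 hmg) hne), .inr fun x hx' hx => ?_⟩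
      obtain ⟨y, hy, hyx⟩ := (lt_isLUB_iff ha).1 hx
      exact hsub (hoc.out hmg hy ⟨by linarith, hyx.le⟩)

theorem exists_gap_with_endpoint_one {E : Set ℝ} (hE : ∀ x ∈ E, |x| ≤ 1) (h1 : (1 : ℝ) ∈ E) :
    ∃ G, IsGap E G ∧ IsEndpoint G 1 := by
  have h2 : (2 : ℝ) ∈ Eᶜ := fun h => by
    have := (abs_le.1 (hE 2 h)).2
    norm_num at this
  refine ⟨_, ⟨2, h2, rfl⟩, .inl ?_⟩
  have hoc := (isPreconnected_connectedComponentIn (F := Eᶜ) (x := 2)).ordConnected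
  have : connectedComponentIn Eᶜ 2 = Ioi (1 : ℝ) := by
    apply Subset.antisymm
    · intro y hy
      by_contra hle
      exact connectedComponentIn_subset Eᶜ 2
        (hoc.out hy (mem_connectedComponentIn h2) ⟨not_lt.1 hle, one_le_two⟩) h1
    · refine isPreconnected_Ioi.subset_connectedComponentIn (by norm_num) fun y hy h => ?_
      exact not_le.2 hy (abs_le.1 (hE y h)).2
  rw [this]
  exact isGLB_Ioi

/-- One point chosen from each of finitely many gaps would form a finite set avoiding a
neighbourhood of x. -/
theorem infinite_gaps {E : Set ℝ} {x : ℝ} (hx : x ∈ E)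
    (h : IsAccumulatedByGapsAndComponents E x) : {G : Set ℝ | IsGap E G}.Infinite := by
  intro hfin
  have hpt : ∀ G, IsGap E G → ∃ y ∈ G, y ≠ x := by
    rintro _ ⟨g, hg, rfl⟩
    exact ⟨g, mem_connectedComponentIn hg, fun h => hg (h ▸ hx)⟩
  choose! f hf hfx using hpt
  have hcl : IsClosed (f '' {G | IsGap E G}) := (hfin.image f).isClosed
  have hm : x ∈ (f '' {G | IsGap E G})ᶜ := by
    rintro ⟨G, hG, rfl⟩
    exact hfx G hG rfl
  obtain ⟨ε, hε, hb⟩ := Metric.isOpen_iff.1 hcl.isOpen_compl x hm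
  obtain ⟨⟨G, hG, hGs⟩, -⟩ := h ε hε
  exact hb (by rw [Real.ball_eq_Ioo]; exact hGs (hf G hG)) ⟨G, hG, rfl⟩

theorem interior_nonempty_of_isProperComponent {E K : Set ℝ} (hK : IsProperComponent E K) :
    (interior E).Nonempty := by
  obtain ⟨⟨x, hx, rfl⟩, a, ha, b, hb, hab⟩ := hK
  have hoc := (isPreconnected_connectedComponentIn (F := E) (x := x)).ordConnected
  have hsub := hoc.uIcc_subset ha hb |>.trans (connectedComponentIn_subset E x)
  refine Nonempty.mono (interior_mono hsub) ?_
  rw [uIcc, interior_Icc, nonempty_Ioo]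
  exact inf_lt_sup.2 hab

/-! ### Digit sets with a gap and nonempty interior -/

/-- The word p^k - 1 has all digits p - 1, and p^k is too large to be a word of length k. -/
theorem tower_mem_iff {A : Finset ℤ} {p : ℕ} (hp : 2 ≤ p) (hA : ∀ d ∈ A, |d| < p)
    (h1 : (p : ℤ) - 1 ∈ A) (k : ℕ) {y : ℝ} (hy0 : 0 < y) (hy1 : y < 1) :
    1 - (1 - y) / p ^ k ∈ digitSet A p ↔ y ∈ digitSet A p := by
  have hpn : (0 : ℝ) < (p : ℝ) ^ k := by positivity
  rw [← word_add_div_mem_iff hp hA (pow_sub_one_mem_digitWords h1 k)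
    (fun h => by simpa using abs_lt.1 (abs_lt_of_mem_digitWords hA h)) hy0 hy1]
  congr! 1
  push_cast
  field_simp
  ring

theorem exists_tower_gt {p : ℕ} (hp : 2 ≤ p) (y : ℝ) {z : ℝ} (hz : z < 1) :
    ∃ k : ℕ, z < 1 - (1 - y) / p ^ k := by
  obtain ⟨k, hk⟩ := pow_unbounded_of_one_lt ((1 - y) / (1 - z)) (by exact_mod_cast hp : (1 : ℝ) < p)
  have hpn : (0 : ℝ) < (p : ℝ) ^ k := by positivity
  refine ⟨k, ?_⟩
  rw [div_lt_iff₀ (by linarith)] at hk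
  rw [lt_sub_comm, div_lt_iff₀ hpn]
  linarith

theorem tower_lt_one {p : ℕ} (hp : 2 ≤ p) {y : ℝ} (hy : y < 1) (k : ℕ) :
    1 - (1 - y) / (p : ℝ) ^ k < 1 := by
  have : 0 < (1 - y) / (p : ℝ) ^ k := div_pos (by linarith) (by positivity)
  linarith

theorem le_tower {p : ℕ} (hp : 2 ≤ p) {y : ℝ} (hy : y < 1) (k : ℕ) :
    y ≤ 1 - (1 - y) / (p : ℝ) ^ k := by
  have : (1 - y) / (p : ℝ) ^ k ≤ 1 - y :=
    div_le_self (by linarith) (one_le_pow₀ (by exact_mod_cast (by omega : 1 ≤ p)))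
  linarith

theorem Icc_subset_of_scaling {E : Set ℝ} {a q : ℝ} (hq : 0 < q)
    (h : ∀ y, 0 < y → y < 1 → (a - (1 - y) / q ∈ E ↔ y ∈ E)) {c d : ℝ} (hc : 0 < c) (hd : d < 1)
    (hI : Icc c d ⊆ E) : Icc (a - (1 - c) / q) (a - (1 - d) / q) ⊆ E := by
  rintro x ⟨hx1, hx2⟩
  have e : x = a - (1 - (1 - (a - x) * q)) / q := by field_simp; ring
  have b1 : c ≤ 1 - (a - x) * q := by
    have := (le_div_iff₀ hq).1 (sub_le_comm.1 hx1)
    linarith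
  have b2 : 1 - (a - x) * q ≤ d := by
    have := (div_le_iff₀ hq).1 (le_sub_comm.1 hx2)
    linarith
  rw [e]
  exact (h _ (by linarith) (by linarith)).2 (hI ⟨b1, b2⟩)

theorem exists_component_between_gaps {A : Finset ℤ} {p : ℕ} (hp : 2 ≤ p)
    (hA : ∀ d ∈ A, |d| < p) (h1 : (p : ℤ) - 1 ∈ A) (hneg : ∀ d ∈ A, -d ∈ A)
    (hint : (interior (digitSet A p)).Nonempty) {g : ℝ} (hg0 : 0 < g) (hg1 : g < 1)
    (hg : g ∉ digitSet A p) :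
    ∃ u c d v : ℝ, 0 < u ∧ u < c ∧ c < d ∧ d < v ∧ v < 1 ∧ u ∉ digitSet A p ∧
      v ∉ digitSet A p ∧ Icc c d ⊆ digitSet A p := by
  obtain ⟨c, d, hc0, hcd, hd1, hI⟩ : ∃ c d : ℝ, 0 < c ∧ c < d ∧ d < 1 ∧
      Icc c d ⊆ digitSet A p := by
    obtain ⟨x, hx⟩ := hint
    obtain ⟨ε, hε, hb⟩ := Metric.isOpen_iff.1 isOpen_interior x hx
    rw [Real.ball_eq_Ioo] at hb
    obtain ⟨y, hy, hyb⟩ : ∃ y : ℝ, 0 ≤ y ∧ Ioo (y - ε) (y + ε) ⊆ digitSet A p := by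
      rcases le_total 0 x with h | h
      · exact ⟨x, h, hb.trans interior_subset⟩
      · refine ⟨-x, by linarith, fun z hz => ?_⟩
        rw [← neg_neg z]
        exact neg_mem_digitSet hneg (interior_subset
          (hb ⟨by linarith [hz.2], by linarith [hz.1]⟩))
    have h3 := (abs_le.1 (abs_le_one_of_mem_digitSet hp hA
      (hyb (show y + 3 * ε / 4 ∈ _ from ⟨by linarith, by linarith⟩)))).2
    exact ⟨y + ε / 4, y + ε / 2, by linarith, by linarith, by linarith,
      fun z hz => hyb ⟨by linarith [hz.1], by linarith [hz.2]⟩⟩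
  -- Push the interval towards 1 past g, then a copy of g past the interval.
  obtain ⟨k, hk⟩ := exists_tower_gt hp c hg1
  obtain ⟨j, hj⟩ := exists_tower_gt hp g (tower_lt_one hp hd1 k)
  have hpk : (0 : ℝ) < (p : ℝ) ^ k := by positivity
  refine ⟨g, 1 - (1 - c) / p ^ k, 1 - (1 - d) / p ^ k, 1 - (1 - g) / p ^ j, hg0, hk, by gcongr,
    hj, tower_lt_one hp hg1 j, hg, fun h => hg ((tower_mem_iff hp hA h1 j hg0 hg1).1 h), ?_⟩
  exact Icc_subset_of_scaling hpk (fun y => tower_mem_iff hp hA h1 k) hc0 hd1 hI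

theorem accumulated_left {A : Finset ℤ} {p : ℕ} (hp : 2 ≤ p)
    (hA : ∀ d ∈ A, |d| < p) (h1 : (p : ℤ) - 1 ∈ A) (hneg : ∀ d ∈ A, -d ∈ A)
    (hint : (interior (digitSet A p)).Nonempty) {g : ℝ} (hg0 : 0 < g) (hg1 : g < 1)
    (hg : g ∉ digitSet A p) (h1' : (1 : ℝ) ∈ digitSet A p) {a δ : ℝ}
    (ha : a ∈ digitSet A p) (hδ : 0 < δ) (hgap : ∀ x, a < x → x < a + δ → x ∉ digitSet A p)
    {ε : ℝ} (hε : 0 < ε) :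
    ∃ u c d v : ℝ, a - ε < u ∧ u < c ∧ c < d ∧ d < v ∧ v < a ∧ u ∉ digitSet A p ∧
      v ∉ digitSet A p ∧ Icc c d ⊆ digitSet A p := by
  obtain ⟨n, w, hw, hw', rfl⟩ := exists_word_of_isolated_right hp hA h1' ha hδ hgap
  obtain ⟨u, c, d, v, hu0, huc, hcd, hdv, hv1, hu, hv, hI⟩ :=
    exists_component_between_gaps hp hA h1 hneg hint hg0 hg1 hg
  have hpn : (0 : ℝ) < (p : ℝ) ^ n := by positivity
  -- After division by p^n the copy must lie within ε of the endpoint.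
  obtain ⟨k, hk⟩ := exists_tower_gt hp u (by nlinarith : 1 - ε * p ^ n < 1)
  have hpk : (0 : ℝ) < (p : ℝ) ^ k := by positivity
  have hq : (0 : ℝ) < (p : ℝ) ^ k * p ^ n := by positivity
  have hpk1 : (1 : ℝ) ≤ (p : ℝ) ^ k := one_le_pow₀ (by exact_mod_cast (by omega : 1 ≤ p))
  have hiff : ∀ y : ℝ, 0 < y → y < 1 →
      (((w : ℝ) + 1) / p ^ n - (1 - y) / (p ^ k * p ^ n) ∈ digitSet A p ↔ y ∈ digitSet A p) := by
    intro y hy0 hy1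
    rw [← tower_mem_iff hp hA h1 k hy0 hy1,
      ← word_add_div_mem_iff hp hA hw hw' (hy0.trans_le (le_tower hp hy1 k)) (tower_lt_one hp hy1 k)]
    congr! 1
    field_simp
    ring
  refine ⟨_, _, _, _, ?_, ?_, ?_, ?_, ?_, mt (hiff u hu0 (by linarith)).1 hu,
    mt (hiff v (by linarith) hv1).1 hv,
    Icc_subset_of_scaling hq hiff (hu0.trans huc) (hdv.trans hv1) hI⟩
  · rw [sub_lt_sub_iff_left, ← div_div, div_lt_iff₀ hpn]
    linarith
  · gcongr
  · gcongr
  · gcongr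
  · exact sub_lt_self _ (div_pos (by linarith) hq)

theorem isMCantorval_digitSet {A : Finset ℤ} {p : ℕ} (hp : 2 ≤ p)
    (hA : ∀ d ∈ A, |d| < p) (h1 : (p : ℤ) - 1 ∈ A) (hneg : ∀ d ∈ A, -d ∈ A)
    (hint : (interior (digitSet A p)).Nonempty) {g : ℝ} (hg0 : 0 < g) (hg1 : g < 1)
    (hg : g ∉ digitSet A p) (h0' : (0 : ℝ) ∈ digitSet A p) (h1' : (1 : ℝ) ∈ digitSet A p) :
    IsMCantorval (digitSet A p) := by
  have hperf := perfect_digitSet hp hA h0' h1'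
  have hend : ∀ G, IsGap (digitSet A p) G → ∀ x, IsEndpoint G x →
      IsAccumulatedByGapsAndComponents (digitSet A p) x := by
    intro G hG a haG
    obtain ⟨ha, δ, hδ, hiso⟩ := isolated_of_isEndpoint hperf.closed hG haG
    refine isAccumulatedByGapsAndComponents_of fun ε hε => ?_
    rcases hiso with hiso | hiso
    · obtain ⟨u, c, d, v, q1, q2, q3, q4, q5, q6, q7, q8⟩ :=
        accumulated_left hp hA h1 hneg hint hg0 hg1 hg h1' ha hδ hiso hε
      exact ⟨⟨d, a, v, by linarith, q4, q5, by linarith, q8 ⟨q3.le, le_rfl⟩, q7, ha⟩,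
        u, v, c, d, q1, q2, q3, q4, by linarith, q6, q7, q8⟩
    · have hn : ∀ x, -x ∈ digitSet A p ↔ x ∈ digitSet A p := fun x =>
        ⟨fun h => neg_neg x ▸ neg_mem_digitSet hneg h, neg_mem_digitSet hneg⟩
      obtain ⟨u, c, d, v, q1, q2, q3, q4, q5, q6, q7, q8⟩ :=
        accumulated_left hp hA h1 hneg hint hg0 hg1 hg h1' (a := -a) ((hn a).2 ha) hδ
          (fun x hx hx' h => hiso (-x) (by linarith) (by linarith) ((hn x).2 h)) hε
      rw [← hn] at q6 q7
      refine ⟨⟨a, -d, -v, by linarith, by linarith, by linarith, by linarith, ha, q7,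
        (hn d).2 (q8 ⟨q3.le, le_rfl⟩)⟩, -v, -u, -d, -c, by linarith, by linarith, by linarith,
        by linarith, by linarith, q7, q6, fun x hx => ?_⟩
      exact (hn x).1 (q8 ⟨by linarith [hx.2], by linarith [hx.1]⟩)
  obtain ⟨G, hG, hG1⟩ := exists_gap_with_endpoint_one
    (fun x hx => abs_le_one_of_mem_digitSet hp hA hx) h1'
  exact ⟨hperf, infinite_gaps h1' (hend G hG 1 hG1), hend⟩

/-! ### Differences of symmetric S-Cantor sets -/

-- Differences within the lower or upper blocks give the middle range; differences across them give
-- the two outer ranges.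
open scoped Pointwise in
theorem mem_sCantorDigits_sub {l₁ l₂ p : ℕ} (hl₁ : 1 ≤ l₁) (hl₂ : 1 ≤ l₂) (h₁ : 2 * l₁ < p)
    (h₂ : 2 * l₂ < p) {d : ℤ} :
    d ∈ sCantorDigits l₁ l₁ p - sCantorDigits l₂ l₂ p ↔
      -max (l₁ : ℤ) l₂ < d ∧ d < max (l₁ : ℤ) l₂ ∨ (p : ℤ) - (l₁ + l₂) < d ∧ d < p ∨
        (p : ℤ) - (l₁ + l₂) < -d ∧ -d < p := by
  have hmem : ∀ (l : ℕ) (a : ℤ), a ∈ sCantorDigits l l p ↔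
      0 ≤ a ∧ a < l ∨ (p : ℤ) - l ≤ a ∧ a < p := by
    intro l a
    simp only [sCantorDigits, Finset.mem_union, Finset.mem_Icc]
    omega
  simp only [Finset.mem_sub, hmem]
  constructor
  · rintro ⟨a, ha, b, hb, rfl⟩
    omega
  · intro h
    rcases h with h | h | h
    · rcases le_total l₂ l₁ with hl | hl <;> rcases le_total 0 d with hd | hd
      · exact ⟨d, by omega, 0, by omega, by omega⟩
      · exact ⟨p - 1 + d, by omega, p - 1, by omega, by omega⟩
      · exact ⟨p - 1, by omega, p - 1 - d, by omega, by omega⟩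
      · exact ⟨0, by omega, -d, by omega, by omega⟩
    · by_cases hj : (p : ℤ) - l₁ ≤ d
      · exact ⟨d, by omega, 0, by omega, by omega⟩
      · exact ⟨p - l₁, by omega, p - l₁ - d, by omega, by omega⟩
    · by_cases hj : d ≤ l₁ - p
      · exact ⟨d + p - 1, by omega, p - 1, by omega, by omega⟩
      · exact ⟨l₁ - 1, by omega, l₁ - 1 - d, by omega, by omega⟩

/-- The tail lies in [-1, 1], so the first digit is within 1 of px. -/
theorem digit_of_mem_digitSet {A : Finset ℤ} {p : ℕ} (hp : 2 ≤ p) (hA : ∀ d ∈ A, |d| < p)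
    {x : ℝ} {k : ℤ} (h1 : (k : ℝ) < p * x) (h2 : p * x < k + 1) (hx : x ∈ digitSet A p) :
    k ∈ A ∧ p * x - k ∈ digitSet A p ∨ k + 1 ∈ A := by
  obtain ⟨d, hd, y, hy, rfl⟩ := (mem_digitSet_iff_first hp).1 hx
  have hp0 : (p : ℝ) ≠ 0 := by positivity
  rw [mul_div_cancel₀ _ hp0] at *
  obtain ⟨a1, a2⟩ := abs_le.1 (abs_le_one_of_mem_digitSet hp hA hy)
  have e1 : (k : ℝ) - 1 < d := by linarith
  have e2 : (d : ℝ) < k + 2 := by linarith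
  have e1' : k - 1 < d := by exact_mod_cast e1
  have e2' : d < k + 2 := by exact_mod_cast e2
  obtain rfl | rfl : d = k ∨ d = k + 1 := by omega
  · exact .inl ⟨hd, by simpa using hy⟩
  · exact .inr hd

theorem mainTheorem3 (l₁ l₂ p : ℕ) (hl₁ : 1 ≤ l₁) (hl₂ : 1 ≤ l₂) (hp : 2 < p)
    (h₁ : 2 * l₁ < p) (h₂ : 2 * l₂ < p) :
    (symmSCantor l₁ p - symmSCantor l₂ p = Set.Icc (-1 : ℝ) 1 ↔
      2 * l₁ + l₂ ≥ p ∨ l₁ + 2 * l₂ ≥ p) ∧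
    (IsCantorSet (symmSCantor l₁ p - symmSCantor l₂ p) ↔
      2 * l₁ + 2 * l₂ ≤ p) ∧
    (IsMCantorval (symmSCantor l₁ p - symmSCantor l₂ p) ↔
      2 * l₁ + l₂ < p ∧ l₁ + 2 * l₂ < p ∧ 2 * l₁ + 2 * l₂ > p) := by
  have hp2 : 2 ≤ p := hp.le
  have hp0 : (0 : ℝ) < p := by positivity
  rw [symmSCantor, symmSCantor, sCantor, sCantor, digitSet_sub_digitSet hp2]
  have hD := fun d : ℤ => mem_sCantorDigits_sub (d := d) hl₁ hl₂ h₁ h₂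
  generalize sCantorDigits l₁ l₁ p - sCantorDigits l₂ l₂ p = A at hD ⊢
  have hA : ∀ d ∈ A, |d| < p := fun d hd => by
    rw [hD] at hd
    rw [abs_lt]
    omega
  have hneg : ∀ d ∈ A, -d ∈ A := fun d hd => by
    rw [hD] at hd ⊢
    omega
  have hA0 : (0 : ℤ) ∈ A := by
    rw [hD]
    omega
  have hA1 : (p : ℤ) - 1 ∈ A := by
    rw [hD]
    omega
  have h0 : (0 : ℝ) ∈ digitSet A p := ⟨fun _ => 0, fun _ => hA0, by simp⟩
  have h1 : (1 : ℝ) ∈ digitSet A p :=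
    ⟨fun _ => p - 1, fun _ => hA1, by simpa using hasSum_geometric_digits hp2⟩
  have hbound : ∀ x ∈ digitSet A p, |x| ≤ 1 := fun x => abs_le_one_of_mem_digitSet hp2 hA
  have hfull : 2 * l₁ + l₂ ≥ p ∨ l₁ + 2 * l₂ ≥ p → digitSet A p = Set.Icc (-1 : ℝ) 1 := by
    intro h
    refine Subset.antisymm (fun x hx => abs_le.1 (hbound x hx)) ?_
    refine subset_digitSet_of_covered hp2 hA (fun x hx => abs_le.2 hx) (fun x hx => ?_) hA0
    have hx1 : -(p : ℝ) ≤ p * x := by nlinarith [hx.1]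
    have hx2 : (p : ℝ) * x ≤ p := by nlinarith [hx.2]
    have f1 : -(p : ℤ) ≤ ⌊(p : ℝ) * x⌋ := Int.le_floor.2 (by exact_mod_cast hx1)
    have f2 : ⌊(p : ℝ) * x⌋ ≤ p := by
      exact_mod_cast (Int.floor_le _).trans hx2
    have g1 := Int.floor_le ((p : ℝ) * x)
    have g2 := Int.lt_floor_add_one ((p : ℝ) * x)
    generalize ⌊(p : ℝ) * x⌋ = k at *
    obtain hk | hk | hk : k = p ∨ k ∈ A ∨ k + 1 ∈ A := by
      simp only [hD]
      omega
    -- Only x = 1 gives k = p; the remainder is again 1.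
    · refine ⟨p - 1, hA1, ?_⟩
      subst hk
      push_cast at *
      constructor <;> linarith
    · exact ⟨k, hk, by linarith, by linarith⟩
    · refine ⟨k + 1, hk, ?_⟩
      push_cast
      constructor <;> linarith
  have hgap : 2 * l₁ + l₂ < p → l₁ + 2 * l₂ < p →
      ∃ g : ℝ, 0 < g ∧ g < 1 ∧ g ∉ digitSet A p := by
    intro ha hb
    obtain ⟨m, hm⟩ : ∃ m : ℕ, m = max l₁ l₂ := ⟨_, rfl⟩
    have hmp : (m : ℝ) + 1 ≤ p := by exact_mod_cast (by omega : m + 1 ≤ p)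
    have e : (p : ℝ) * ((m + 1 / 2) / p) = m + 1 / 2 := by field_simp
    refine ⟨(m + 1 / 2) / p, by positivity, (div_lt_one hp0).2 (by linarith), fun hg => ?_⟩
    have := digit_of_mem_digitSet (k := m) hp2 hA (by rw [e]; push_cast; linarith)
      (by rw [e]; push_cast; linarith) hg
    simp only [hD] at this
    omega
  have hint : 2 * l₁ + 2 * l₂ > p → (interior (digitSet A p)).Nonempty := by
    intro h
    refine interior_digitSet_nonempty hp2 hA h0 fun k => ?_
    have r1 := Int.emod_nonneg k (by omega : (p : ℤ) ≠ 0)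
    have r2 := Int.emod_lt_of_pos k (by omega : (0 : ℤ) < p)
    have r3 : (p : ℤ) ∣ k - k % p := Int.dvd_self_sub_emod
    generalize k % (p : ℤ) = r at *
    obtain hr | hr : r ∈ A ∨ r - p ∈ A := by
      simp only [hD]
      omega
    · exact ⟨r, hr, r3⟩
    · refine ⟨r - p, hr, ?_⟩
      rw [← sub_add]
      exact dvd_add r3 dvd_rfl
  have hempty : 2 * l₁ + 2 * l₂ ≤ p → interior (digitSet A p) = ∅ := by
    intro h
    obtain ⟨s, hs⟩ : ∃ s : ℕ, s = l₁ + l₂ := ⟨_, rfl⟩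
    -- For t = (s - δ)/p the digits s - 1 and s are missing. For t - 1 only s - 1 - p is available,
    -- with tail 1 - δ; this δ puts p(1 - δ) midway between the missing digits p - s - 1 and p - s.
    obtain ⟨δ, hδ⟩ : ∃ δ : ℝ, δ = (2 * s + 1) / (2 * p) := ⟨_, rfl⟩
    have hpδ : p * δ = s + 1 / 2 := by
      rw [hδ]
      field_simp
    have hsp : 2 * (s : ℝ) ≤ p := by exact_mod_cast (by omega : 2 * s ≤ p)
    have hs2 : 2 ≤ (s : ℝ) := by exact_mod_cast (by omega : 2 ≤ s)
    have hδ0 : 0 < δ := by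
      rw [hδ]
      positivity
    have hδ1 : δ < 1 := by
      rw [hδ, div_lt_one (by positivity)]
      linarith
    have e : (p : ℝ) * ((s - δ) / p) = s - δ := by field_simp
    have e' : (p : ℝ) * ((s - δ) / p - 1) = s - δ - p := by field_simp
    refine interior_digitSet_eq_empty hp2 hA (t := (s - δ) / p) (div_pos (by linarith) hp0)
      ((div_lt_one hp0).2 (by linarith)) (fun ht => ?_) fun ht => ?_
    · have := digit_of_mem_digitSet (k := s - 1) hp2 hA (by rw [e]; push_cast; linarith)
        (by rw [e]; push_cast; linarith) ht
      simp only [hD] at this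
      omega
    · obtain ⟨-, ht'⟩ | ht' := digit_of_mem_digitSet (k := s - 1 - p) hp2 hA
        (by rw [e']; push_cast; linarith) (by rw [e']; push_cast; linarith) ht
      · rw [e'] at ht'
        push_cast at ht'
        have := digit_of_mem_digitSet (k := p - s - 1) hp2 hA (by push_cast; linarith)
          (by push_cast; linarith) ht'
        simp only [hD] at this
        omega
      · rw [hD] at ht'
        omega
  refine ⟨⟨fun h => ?_, hfull⟩, ⟨fun h => ?_, fun h => ?_⟩, ⟨fun h => ?_, fun h => ?_⟩⟩
  · by_contra! hn
    obtain ⟨g, hg0, hg1, hg⟩ := hgap hn.1 hn.2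
    rw [h] at hg
    exact hg ⟨by linarith, hg1.le⟩
  · by_contra! hn
    have h4 := h.2.2.2
    rw [IsNowhereDense, h.2.1.isClosed.closure_eq] at h4
    exact (hint hn).ne_empty h4
  · refine ⟨⟨0, h0⟩, isCompact_digitSet hp2 hA, perfect_digitSet hp2 hA h0 h1, ?_⟩
    rw [IsNowhereDense, (isCompact_digitSet hp2 hA).isClosed.closure_eq]
    exact hempty h
  · obtain ⟨G, hG, hG1⟩ := exists_gap_with_endpoint_one hbound h1
    -- Radius 1 suffices: the only component of [-1, 1] contains -1, outside (0, 2).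
    obtain ⟨-, K, hK, hKs⟩ := h.2.2 G hG 1 hG1 1 one_pos
    have hlow : 2 * l₁ + 2 * l₂ > p := by
      by_contra! hn
      exact (interior_nonempty_of_isProperComponent hK).ne_empty (hempty hn)
    have hnot : ¬ (2 * l₁ + l₂ ≥ p ∨ l₁ + 2 * l₂ ≥ p) := by
      intro hn
      rw [hfull hn] at hK
      obtain ⟨⟨x, hx, rfl⟩, -⟩ := hK
      have := hKs (isPreconnected_Icc.subset_connectedComponentIn hx Subset.rfl
        (⟨le_rfl, by norm_num⟩ : (-1 : ℝ) ∈ Icc (-1 : ℝ) 1))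
      norm_num at this
    omega
  · obtain ⟨g, hg0, hg1, hg⟩ := hgap h.1 h.2.1
    exact isMCantorval_digitSet hp2 hA hA1 hneg (hint h.2.2) hg0 hg1 hg h0 h1
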